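/- Let $k\ge 2$. A decorated path is a lattice path with up steps $V=(0,1)$ and horizontal steps $H=(1,0)$ that starts in $(0,-1)$ with an up step to $(0,0)$ and after that never crosses the diagonal $y=\frac{x}{k-1}$ (it satisfies $(k-1)y\le x$; touching is allowed). Each $H$-step carries one cross in one of the unit boxes below it and above $y=-1$; its label is the number of the row of that box, the rows being numbered $1,2,\dots$ from the bottom. Each $V$-step is coloured white or green, the initial one white. To each $V$-step we assign the node whose number is the row of that step, and a $k$-tuple of children: the initial step is node $1$ (the sink) with children $(1,\dots,1)$. Read the rest of the path with a list of waiting nodes that at first consists of node $1$ only (the leftmost leaf); an $H$-step appends its label to the list, and a $V$-step removes the last $k$ entries $(v_1,\dots,v_k)$, which are the children of its node, and appends its node. A (automatic) $B$-path is such a coloured path in which, for every $k$ consecutive $H$-steps with labels $(h_1,\dots,h_k)$ that are directly followed by a $V$-step of colour $c$, the pair $((h_1,\dots,h_k),c)$ differs from the pair (tuple of children, colour) of every preceding $V$-step, including the initial one; here the leftmost leaf counts as an $H$-step with label $1$ directly after the initial $V$-step. For integers $n,m\ge 0$ let $b_{n,m}$ be the number of $B$-paths ending in $(n,m)$; this number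 is finite. Put $b_{-1,0}=1$. Then \begin{align*} b_{n,m} &= 2b_{n,m-1} + (m+1)b_{n-1,m} - m\, b_{n-k,m-1} && \text{for } 1 \le m \le \tfrac{n}{k-1},\\ b_{n,m} &= 0 && \text{for } m > \tfrac{n}{k-1},\\ b_{n,0} &= 1 && \text{for } n \ge 0. \end{align*} For every $n\ge 0$, the number of minimal (complete) deterministic finite automata with $n+1$ states, up to isomorphism (renaming of the states), that accept a finite language over an alphabet of $k$ letters is finite and equal to $b_{(k-1)n,n}$. -/

import Mathlib

/-! ### Decorated lattice paths -/

namespace DecoratedPath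

/-- A step of a decorated lattice path: a horizontal step `H = (1,0)` together with the row `c` of
its cross, or an up step `V = (0,1)` together with its colour (`true` is green, i.e. accepting,
`false` is white, i.e. rejecting). -/
inductive Step : Type
  | H (c : ℕ) : Step
  | V (green : Bool) : Step

/- A path is recorded as the list of its steps with the MOST RECENT STEP FIRST: `s :: q` is the
path `q` followed by the step `s`. The forced initial up step from `(0,-1)` to `(0,0)`, which stands
for the sink and is white, is left implicit, so `[]` is the path that ends in `(0,0)`.
Rows are numbered from the bottom: row `0` lies between `y = -1` and `y = 0` (the row of the initial
up step), and row `j` lies between `y = j - 1` and `y = j` (the row of the `j`-th later up step).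
The node that belongs to an up step carries the number of its row; thus the sink is node `0`. -/

/-- The `x`-coordinate of the end point of a path. -/
def xEnd : List Step → ℕ
  | [] => 0
  | Step.H _ :: q => xEnd q + 1
  | Step.V _ :: q => xEnd q

/-- The `y`-coordinate of the end point of a path. -/
def yEnd : List Step → ℕ
  | [] => 0
  | Step.H _ :: q => yEnd q
  | Step.V _ :: q => yEnd q + 1

/-- The nodes (rightmost, i.e. most recent, first) that still wait for a parent after the postorder
construction has followed the path. At the beginning this is only the sink, reached as the leftmost
leaf of the spine. A horizontal step adds a pointer to the node in the row of its cross; an up step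
creates the next node, whose children are the last `k` waiting nodes. -/
def waiting (k : ℕ) : List Step → List ℕ
  | [] => [0]
  | Step.H c :: q => c :: waiting k q
  | Step.V _ :: q => (yEnd q + 1) :: (waiting k q).drop k

/-- The `k`-tuple of children, from left to right, of the node created by an up step that follows
the path `q`. -/
def children (k : ℕ) (q : List Step) : List ℕ :=
  ((waiting k q).take k).reverse

/-- The tuples of children and the colours of all up steps of a path, including the initial one: the
sink is white and all its `k` children are the sink itself. -/
def upSteps (k : ℕ) : List Step → List (List ℕ × Bool)
  | [] => [(List.replicate k 0, false)]
  | Step.H _ :: q => upSteps k q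
  | Step.V g :: q => (children k q, g) :: upSteps k q

/-- The path `q` ends with consecutive horizontal steps whose decorations are `h` (from left to
right). Here the leftmost leaf of the spine, which is the sink, counts as a horizontal step with
decoration `0` that directly follows the initial up step. -/
def EndsWithH (q : List Step) (h : List ℕ) : Prop :=
  (h.reverse.map Step.H) <+: (q ++ [Step.H 0])

/-- B-paths: the path never crosses the diagonal `y = x / (k - 1)`; the cross of every horizontal step
lies in one of the unit boxes between `y = -1` and that step; up steps are coloured white or green;
and for consecutive steps `H^k V` the decorations of the `H`-steps together with the colour of the
`V`-step differ from the tuple of children together with the colour of every preceding up step. -/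
def IsBPath (k : ℕ) : List Step → Prop
  | [] => True
  | Step.H c :: q => IsBPath k q ∧ c ≤ yEnd q
  | Step.V g :: q =>
      IsBPath k q ∧ (k - 1) * (yEnd q + 1) ≤ xEnd q ∧
        ∀ h : List ℕ, h.length = k → EndsWithH q h → (h, g) ∉ upSteps k q

/-- The B-paths that end in `(n, m)`. -/
def BPath (k n m : ℕ) : Type :=
  {p : List Step // IsBPath k p ∧ xEnd p = n ∧ yEnd p = m}

/-- The number `b_{n,m}` of B-paths that end in `(n, m)`, for `n, m ≥ 0`, with the boundary
convention `b_{-1,0} = 1`. (The value `0` at all other negative `n` is not used.) -/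
noncomputable def b (k : ℕ) (n : ℤ) (m : ℕ) : ℤ :=
  if 0 ≤ n then (Nat.card (BPath k n.toNat m) : ℤ)
  else if n = -1 ∧ m = 0 then 1 else 0

end DecoratedPath

/-! ### Minimal automata of finite languages -/

namespace MinimalAutomaton

/-- A deterministic finite automaton is minimal if no deterministic finite automaton with fewer
states accepts the same language. -/
def IsMinimal {α : Type*} {s : ℕ} (M : DFA α (Fin s)) : Prop :=
  ∀ (t : ℕ) (M' : DFA α (Fin t)), M'.accepts = M.accepts → s ≤ t

/-- Minimal automata with state set `Fin s` that accept a finite language over the alphabet `α`. -/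
def MinDFA (α : Type*) (s : ℕ) : Type _ :=
  {M : DFA α (Fin s) // IsMinimal M ∧ {w : List α | w ∈ M.accepts}.Finite}

/-- Isomorphism of automata: a renaming of the states. -/
instance isoSetoid (α : Type*) (s : ℕ) : Setoid (MinDFA α s) where
  r M N := ∃ e : Fin s ≃ Fin s, DFA.reindex e M.1 = N.1
  iseqv :=
    { refl := fun M => ⟨Equiv.refl _, by simp⟩
      symm := by
        rintro M N ⟨e, h⟩
        exact ⟨e.symm, by rw [← h, ← DFA.symm_reindex, Equiv.symm_apply_apply]⟩
      trans := by
        rintro M N P ⟨e, h⟩ ⟨f, h'⟩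
        refine ⟨e.trans f, ?_⟩
        rw [← h', ← h]
        rfl }

/-- Minimal automata with `s` states that accept a finite language over `α`, up to isomorphism. -/
def MinDFAClass (α : Type*) (s : ℕ) : Type _ := Quotient (isoSetoid α s)

end MinimalAutomaton

namespace DecoratedPath

variable {k : ℕ}

/-! ### Combinatorics of B-paths -/

/-! Recurrence: delete the last step of a path. A final `H` leaves a shorter path and a free choice
of row. A final `V` leaves a path and one of two colours, except for the pairs that repeat an
earlier (children, colour) pair. Earlier tuples cannot contain the newest node, so a repetition can
occur only after `k` horizontal steps, possibly counting the leftmost leaf (`prefix_or_yEnd_mem`,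
`isBPath_V_iff`). Deleting these steps leaves a shorter path with one of its pairwise distinct up
steps marked, which gives the subtracted term (`bijective_repeatUpStep`). The boundary value at `-1`
counts the one repetition that uses the leaf.

Automata: by Myhill–Nerode, a minimal automaton up to isomorphism is a language, and its states are
the left quotients (`isMinimal_iff`, `IsMinimal.exists_reindex_eq`). Each row of a path is read as a
finite language, the sink as the empty one. Since up steps do not repeat, distinct rows get distinct
languages (`IsBPath.injOn_rowLang`), and these are exactly the quotients of the waiting languages
(`IsBPath.quotients_forest`).

The list of waiting languages determines the path: its newest entry is a quotient of the others
after an `H`, and is not after a `V` (`forest_injective`). Conversely, this criterion rebuilds a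
path from any nonempty list of finite languages with finitely many quotients (`exists_forest_eq`).
At `((k - 1) * n, n)` one language waits, and it has `n + 1` quotients. -/

theorem IsBPath.le_diagonal {q : List Step} (hq : IsBPath k q) : (k - 1) * yEnd q ≤ xEnd q := by
  induction q with
  | nil => simp [yEnd, xEnd]
  | cons s q ih =>
    cases s with
    | H c => exact (ih hq.1).trans (Nat.le_succ _)
    | V g => exact hq.2.1

/-- An `H` adds one waiting node and a `V` trades `k` for one. Hence the diagonal condition says
exactly that enough nodes wait for the next up step. -/
theorem IsBPath.length_waiting (hk : 2 ≤ k) {q : List Step} (hq : IsBPath k q) :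
    (waiting k q).length + (k - 1) * yEnd q = xEnd q + 1 := by
  induction q with
  | nil => simp [yEnd, xEnd, waiting]
  | cons s q ih =>
    cases s with
    | H c =>
      have := ih hq.1
      simp only [waiting, yEnd, xEnd, List.length_cons]
      omega
    | V g =>
      have h1 := ih hq.1
      have h2 := hq.2.1
      simp only [waiting, yEnd, xEnd, List.length_cons, List.length_drop, Nat.mul_succ] at *
      omega

theorem IsBPath.le_length_waiting (hk : 2 ≤ k) {q : List Step} (hq : IsBPath k q)
    (h : (k - 1) * (yEnd q + 1) ≤ xEnd q) : k ≤ (waiting k q).length := by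
  have := hq.length_waiting hk
  rw [Nat.mul_succ] at h
  omega

theorem length_children {q : List Step} (h : k ≤ (waiting k q).length) :
    (children k q).length = k := by
  simpa [children] using h

theorem IsBPath.le_of_mem_waiting {q : List Step} (hq : IsBPath k q) {c : ℕ}
    (hc : c ∈ waiting k q) : c ≤ yEnd q := by
  induction q with
  | nil => simpa [waiting, yEnd] using hc
  | cons s q ih =>
    cases s with
    | H d =>
      rcases List.mem_cons.1 hc with rfl | hc
      · exact hq.2
      · exact ih hq.1 hc
    | V g =>
      rcases List.mem_cons.1 hc with rfl | hc
      · exact le_rfl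
      · exact (ih hq.1 (List.mem_of_mem_drop hc)).trans (Nat.le_succ _)

theorem IsBPath.le_of_mem_children {q : List Step} (hq : IsBPath k q) {c : ℕ}
    (hc : c ∈ children k q) : c ≤ yEnd q :=
  hq.le_of_mem_waiting (List.mem_of_mem_take (List.mem_reverse.1 hc))

theorem length_upSteps (q : List Step) : (upSteps k q).length = yEnd q + 1 := by
  induction q with
  | nil => rfl
  | cons s q ih => cases s <;> simp [upSteps, yEnd, ih]

/-- Children of a later node were created before it. The truncated subtraction covers the sink,
which is its own child. -/
theorem IsBPath.of_mem_upSteps (hk : 2 ≤ k) {q : List Step} (hq : IsBPath k q)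
    {u : List ℕ × Bool} (hu : u ∈ upSteps k q) :
    u.1.length = k ∧ ∀ c ∈ u.1, c ≤ yEnd q - 1 := by
  induction q with
  | nil =>
    obtain rfl : u = _ := by simpa [upSteps] using hu
    simp [yEnd]
  | cons s q ih =>
    cases s with
    | H d => exact ih hq.1 hu
    | V g =>
      rcases List.mem_cons.1 hu with rfl | hu
      · exact ⟨length_children (hq.1.le_length_waiting hk hq.2.1),
          fun c hc => hq.1.le_of_mem_children hc⟩
      · obtain ⟨h1, h2⟩ := ih hq.1 hu
        exact ⟨h1, fun c hc => (h2 c hc).trans (by simp [yEnd])⟩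

theorem prefix_waiting_of_prefix (q : List Step) (h : List ℕ)
    (hh : h.map Step.H <+: q ++ [Step.H 0]) : h <+: waiting k q := by
  induction q generalizing h with
  | nil =>
    cases h with
    | nil => exact List.nil_prefix
    | cons c h =>
      simpa [waiting, List.cons_prefix_cons] using hh
  | cons s q ih =>
    cases h with
    | nil => exact List.nil_prefix
    | cons c h =>
      rw [List.map_cons, List.cons_append, List.cons_prefix_cons] at hh
      obtain ⟨rfl, hh⟩ := hh
      exact List.cons_prefix_cons.2 ⟨rfl, ih h hh⟩

theorem EndsWithH.eq_children {q : List Step} {h : List ℕ} (hh : EndsWithH q h)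
    (hl : h.length = k) : h = children k q := by
  have := List.prefix_iff_eq_take.1 (prefix_waiting_of_prefix (k := k) q _ hh)
  rw [List.length_reverse, hl] at this
  rw [children, ← this, List.reverse_reverse]

/-- Reading backwards, either only horizontal steps are met, or the first up step met contributes
the newest node. -/
theorem prefix_or_yEnd_mem (q : List Step) (j : ℕ) (hj : j ≤ (waiting k q).length) :
    ((waiting k q).take j).map Step.H <+: q ++ [Step.H 0] ∨
      1 ≤ yEnd q ∧ yEnd q ∈ (waiting k q).take j := by
  induction q generalizing j with
  | nil =>
    left
    rcases j with _ | j
    · simp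
    · simp [waiting]
  | cons s q ih =>
    rcases j with _ | j
    · left; simp
    cases s with
    | H c =>
      rcases ih j (by simpa [waiting] using hj) with h | ⟨h1, h2⟩
      · left
        simpa [waiting, List.cons_prefix_cons] using h
      · right
        exact ⟨h1, by simp [waiting, yEnd, h2]⟩
    | V g => right; simp [waiting, yEnd]

theorem IsBPath.endsWithH_children (hk : 2 ≤ k) {q : List Step} (hq : IsBPath k q) {g : Bool}
    (h : k ≤ (waiting k q).length) (hu : (children k q, g) ∈ upSteps k q) :
    EndsWithH q (children k q) := by
  rcases prefix_or_yEnd_mem q k h with h | ⟨h1, h2⟩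
  · simpa [EndsWithH, children] using h
  · have := (hq.of_mem_upSteps hk hu).2 _ (List.mem_reverse.2 h2)
    omega

/-- An up step is allowed exactly if it does not repeat the children and the colour of an earlier
up step. -/
theorem isBPath_V_iff (hk : 2 ≤ k) {q : List Step} {g : Bool} :
    IsBPath k (Step.V g :: q) ↔ IsBPath k q ∧ (k - 1) * (yEnd q + 1) ≤ xEnd q ∧
      (children k q, g) ∉ upSteps k q := by
  refine and_congr_right fun hq => and_congr_right fun hd => ?_
  have hw := hq.le_length_waiting hk hd
  constructor
  · intro h hu
    exact h _ (length_children hw) (hq.endsWithH_children hk hw hu) hu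
  · intro h h' hl he hu
    rw [he.eq_children hl] at hu
    exact h hu

theorem IsBPath.nodup_upSteps (hk : 2 ≤ k) {q : List Step} (hq : IsBPath k q) :
    (upSteps k q).Nodup := by
  induction q with
  | nil => simp [upSteps]
  | cons s q ih =>
    cases s with
    | H c => exact ih hq.1
    | V g =>
      have := (isBPath_V_iff hk).1 hq
      exact List.nodup_cons.2 ⟨this.2.2, ih hq.1⟩

/-! ### Counting B-paths -/

theorem length_eq (q : List Step) : q.length = xEnd q + yEnd q := by
  induction q with
  | nil => rfl
  | cons s q ih => cases s <;> simp [xEnd, yEnd, ih] <;> omega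

/-- B-paths whose last step is horizontal. -/
def appendH (n m : ℕ) (x : Fin (m + 1) × BPath k n m) : BPath k (n + 1) m :=
  ⟨Step.H x.1 :: x.2.1, ⟨x.2.2.1, by rw [x.2.2.2.2]; omega⟩, by simp [xEnd, x.2.2.2.1],
    by simp [yEnd, x.2.2.2.2]⟩

/-- The pairs of a B-path and a colour such that the up step of this colour repeats an earlier
one. -/
def Forbidden (k n m : ℕ) : Type :=
  {x : BPath k n m × Bool // (children k x.1.1, x.2) ∈ upSteps k x.1.1}

/-- The pairs of a B-path and a colour such that the up step of this colour is new. -/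
def Allowed (k n m : ℕ) : Type :=
  {x : BPath k n m × Bool // (children k x.1.1, x.2) ∉ upSteps k x.1.1}

/-- B-paths whose last step is an up step. -/
def appendV (hk : 2 ≤ k) (n m : ℕ) (hd : (k - 1) * (m + 1) ≤ n) (x : Allowed k n m) :
    BPath k n (m + 1) :=
  ⟨Step.V x.1.2 :: x.1.1.1, (isBPath_V_iff hk).2 ⟨x.1.1.2.1, by
    rw [x.1.1.2.2.1, x.1.1.2.2.2]; exact hd, x.2⟩, by simp [xEnd, x.1.1.2.2.1],
    by simp [yEnd, x.1.1.2.2.2]⟩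

/-- Classification by the last step; the empty path is excluded by its `x`-coordinate. -/
theorem bijective_append (hk : 2 ≤ k) (n m : ℕ) (hd : (k - 1) * (m + 1) ≤ n + 1) :
    Function.Bijective (Sum.elim (appendH (k := k) n (m + 1)) (appendV hk (n + 1) m hd)) := by
  constructor
  · rintro (⟨c, p, hp⟩ | ⟨⟨⟨p, hp⟩, g⟩, hx⟩) (⟨c', p', hp'⟩ | ⟨⟨⟨p', hp'⟩, g'⟩, hx'⟩) h
    · have h1 : Step.H c :: p = Step.H c' :: p' := congrArg Subtype.val h
      rw [List.cons.injEq, Step.H.injEq] at h1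
      obtain ⟨h1, rfl⟩ := h1
      obtain rfl := Fin.ext h1
      rfl
    · have h1 : Step.H c :: p = Step.V g' :: p' := congrArg Subtype.val h
      simp at h1
    · have h1 : Step.V g :: p = Step.H c' :: p' := congrArg Subtype.val h
      simp at h1
    · have h1 : Step.V g :: p = Step.V g' :: p' := congrArg Subtype.val h
      rw [List.cons.injEq, Step.V.injEq] at h1
      obtain ⟨rfl, rfl⟩ := h1
      rfl
  · rintro ⟨p, hp, hx, hy⟩
    cases p with
    | nil => simp [xEnd] at hx
    | cons s p =>
      cases s with
      | H c =>
        have hc := hp.2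
        simp only [xEnd, yEnd] at hx hy
        exact ⟨Sum.inl (⟨c, by omega⟩, ⟨p, hp.1, by omega, hy⟩), rfl⟩
      | V g =>
        simp only [xEnd, yEnd] at hx hy
        exact ⟨Sum.inr ⟨(⟨p, hp.1, hx, by omega⟩, g), ((isBPath_V_iff hk).1 hp).2.2⟩, rfl⟩

theorem isEmpty_bPath {n m : ℕ} (h : n < (k - 1) * m) : IsEmpty (BPath k n m) := by
  refine ⟨fun p => ?_⟩
  have := p.2.1.le_diagonal
  rw [p.2.2.1, p.2.2.2] at this
  omega

theorem bPath_row_zero {n : ℕ} {p : List Step} (hp : IsBPath k p) (hx : xEnd p = n)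
    (hy : yEnd p = 0) : p = List.replicate n (Step.H 0) := by
  induction p generalizing n with
  | nil => subst hx; rfl
  | cons s p ih =>
    cases s with
    | H c =>
      subst hx
      have hc : c = 0 := Nat.le_zero.1 (hp.2.trans hy.le)
      rw [xEnd, List.replicate_succ, hc, ← ih hp.1 rfl hy]
    | V g => simp [yEnd] at hy

theorem isBPath_replicate (n : ℕ) : IsBPath k (List.replicate n (Step.H 0)) := by
  induction n with
  | zero => exact trivial
  | succ n ih => exact ⟨ih, Nat.zero_le _⟩

theorem xEnd_replicate (n : ℕ) : xEnd (List.replicate n (Step.H 0)) = n := by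
  induction n with
  | zero => rfl
  | succ n ih => simp [List.replicate_succ, xEnd, ih]

theorem yEnd_replicate (n : ℕ) : yEnd (List.replicate n (Step.H 0)) = 0 := by
  induction n with
  | zero => rfl
  | succ n ih => simp [List.replicate_succ, yEnd, ih]

theorem waiting_replicate (n : ℕ) :
    waiting k (List.replicate n (Step.H 0)) = List.replicate (n + 1) 0 := by
  induction n with
  | zero => rfl
  | succ n ih => rw [List.replicate_succ, waiting, ih, ← List.replicate_succ]

theorem upSteps_replicate (n : ℕ) :
    upSteps k (List.replicate n (Step.H 0)) = [(List.replicate k 0, false)] := by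
  induction n with
  | zero => rfl
  | succ n ih => rw [List.replicate_succ, upSteps, ih]

/-- The only B-path that ends in `(n, 0)`. -/
def flatPath (k n : ℕ) : BPath k n 0 :=
  ⟨List.replicate n (Step.H 0), isBPath_replicate n, xEnd_replicate n, yEnd_replicate n⟩

theorem eq_flatPath {n : ℕ} (p : BPath k n 0) : p = flatPath k n :=
  Subtype.ext (bPath_row_zero p.2.1 p.2.2.1 p.2.2.2)

theorem card_bPath_zero (n : ℕ) : Nat.card (BPath k n 0) = 1 := by
  have : Unique (BPath k n 0) := ⟨⟨flatPath k n⟩, eq_flatPath⟩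
  exact Nat.card_unique

theorem finite_bPath (hk : 2 ≤ k) (n m : ℕ) : Finite (BPath k n m) := by
  induction m generalizing n with
  | zero =>
    have : Unique (BPath k n 0) := ⟨⟨flatPath k n⟩, eq_flatPath⟩
    infer_instance
  | succ m ihm =>
    induction n with
    | zero =>
      have : IsEmpty (BPath k 0 (m + 1)) := isEmpty_bPath (Nat.mul_pos (by omega) (by omega))
      infer_instance
    | succ n ihn =>
      by_cases hd : (k - 1) * (m + 1) ≤ n + 1
      · have := ihm (n + 1)
        have : Finite (Allowed k (n + 1) m) := Subtype.finite
        exact Finite.of_surjective _ (bijective_append hk n m hd).2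
      · have : IsEmpty (BPath k (n + 1) (m + 1)) := isEmpty_bPath (by omega)
        infer_instance

/-- Stated additively to avoid truncated subtraction; at height `m + 1` there are `m + 2` rows for a
cross. -/
theorem card_bPath_add (hk : 2 ≤ k) (n m : ℕ) (hd : (k - 1) * (m + 1) ≤ n + 1) :
    Nat.card (BPath k (n + 1) (m + 1)) + Nat.card (Forbidden k (n + 1) m) =
      2 * Nat.card (BPath k (n + 1) m) + (m + 2) * Nat.card (BPath k n (m + 1)) := by
  have h1 := Nat.card_eq_of_bijective _ (bijective_append hk n m hd)
  have := finite_bPath hk (n + 1) m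
  have := finite_bPath hk n (m + 1)
  have : Finite (Allowed k (n + 1) m) := Subtype.finite
  have : Finite (Forbidden k (n + 1) m) := Subtype.finite
  classical
  have h2 := Nat.card_congr (Equiv.sumCompl fun x : BPath k (n + 1) m × Bool =>
    (children k x.1.1, x.2) ∈ upSteps k x.1.1)
  have h3 : Nat.card (Forbidden k (n + 1) m) + Nat.card (Allowed k (n + 1) m) =
      Nat.card (BPath k (n + 1) m) * 2 := by
    rw [Nat.card_sum, Nat.card_prod, Nat.card_eq_fintype_card (α := Bool), Fintype.card_bool] at h2
    exact h2
  rw [Nat.card_sum, Nat.card_prod, Nat.card_fin] at h1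
  rw [← h1]
  linarith

/-! ### Prepending horizontal steps and counting the repeated up steps -/

theorem yEnd_append_H (h : List ℕ) (q : List Step) : yEnd (h.map Step.H ++ q) = yEnd q := by
  induction h with
  | nil => rfl
  | cons c h ih => exact ih

theorem isBPath_append_H {q : List Step} (h : List ℕ) :
    IsBPath k (h.map Step.H ++ q) ↔ IsBPath k q ∧ ∀ c ∈ h, c ≤ yEnd q := by
  induction h with
  | nil => simp
  | cons c h ih =>
    simp only [List.map_cons, List.cons_append, IsBPath, ih, yEnd_append_H, List.forall_mem_cons]
    tauto

theorem xEnd_append_H (h : List ℕ) (q : List Step) :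
    xEnd (h.map Step.H ++ q) = xEnd q + h.length := by
  induction h with
  | nil => rfl
  | cons c h ih => simp [xEnd, ih]; omega

theorem upSteps_append_H (h : List ℕ) (q : List Step) :
    upSteps k (h.map Step.H ++ q) = upSteps k q := by
  induction h with
  | nil => rfl
  | cons c h ih => exact ih

theorem waiting_append_H (h : List ℕ) (q : List Step) :
    waiting k (h.map Step.H ++ q) = h ++ waiting k q := by
  induction h with
  | nil => rfl
  | cons c h ih => simp [waiting, ih]

theorem children_append_H {h : List ℕ} (hl : h.length = k) (q : List Step) :
    children k (h.reverse.map Step.H ++ q) = h := by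
  rw [children, waiting_append_H, List.take_left' (by simpa using hl), List.reverse_reverse]

/-- A repeated up step is given by a path and one of its up steps: its children become `k`
horizontal steps. -/
def repeatUpStep (hk : 2 ≤ k) (n m : ℕ)
    (x : Σ p : BPath k n m, {u : List ℕ × Bool // u ∈ upSteps k p.1}) :
    Forbidden k (n + k) m :=
  have hu := x.1.2.1.of_mem_upSteps hk x.2.2
  ⟨(⟨x.2.1.1.reverse.map Step.H ++ x.1.1, (isBPath_append_H _).2 ⟨x.1.2.1, fun c hc =>
      (hu.2 c (List.mem_reverse.1 hc)).trans (Nat.sub_le _ _)⟩,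
      by rw [xEnd_append_H, List.length_reverse, hu.1, x.1.2.2.1],
      by rw [yEnd_append_H, x.1.2.2.2]⟩, x.2.1.2), by
    simp only [children_append_H hu.1, upSteps_append_H]
    exact x.2.2⟩

theorem bijective_repeatUpStep (hk : 2 ≤ k) (n m : ℕ) (hd : (k - 1) * (m + 1) ≤ n + k) :
    Function.Bijective (repeatUpStep (k := k) hk n m) := by
  constructor
  · rintro ⟨⟨p, hp⟩, ⟨⟨h, g⟩, hu⟩⟩ ⟨⟨p', hp'⟩, ⟨⟨h', g'⟩, hu'⟩⟩ he
    have hl : h.length = k := (hp.1.of_mem_upSteps hk hu).1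
    have hl' : h'.length = k := (hp'.1.of_mem_upSteps hk hu').1
    obtain rfl : g = g' := congrArg (fun x : Forbidden k (n + k) m => x.1.2) he
    have h1 : h.reverse.map Step.H ++ p = h'.reverse.map Step.H ++ p' :=
      congrArg (fun x : Forbidden k (n + k) m => x.1.1.1) he
    obtain ⟨h2, rfl⟩ := List.append_inj h1 (by simp [hl, hl'])
    have h3 : h = h' := by
      rw [← children_append_H hl p, h1, children_append_H hl' p]
    subst h3
    rfl
  · rintro ⟨⟨⟨q, hq, hx, hy⟩, g⟩, hu⟩
    dsimp only at hu
    have hw := hq.le_length_waiting hk (by rw [hx, hy]; exact hd)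
    have hl := length_children hw
    obtain ⟨t, ht⟩ := hq.endsWithH_children hk hw hu
    -- If nothing else remained, the leftmost leaf would be among the `k` steps, and `q` would have
    -- only `k - 1` steps, too few to reach `x = n + k`.
    rcases List.eq_nil_or_concat t with rfl | ⟨p, s, rfl⟩
    · have h1 := congrArg xEnd ht
      have h2 := congrArg List.length ht
      have h3 := length_eq q
      have h4 := congrArg yEnd ht
      rw [yEnd_append_H] at h4
      simp only [List.append_nil, List.length_map, List.length_reverse, hl, List.length_append,
        List.length_singleton] at h2
      omega
    · rw [List.concat_eq_append, ← List.append_assoc] at ht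
      obtain ⟨h1, h2⟩ := List.append_inj' ht rfl
      have hq' := hq
      have hu' := hu
      have hx' := hx
      have hy' := hy
      rw [← h1, isBPath_append_H] at hq'
      rw [← h1, upSteps_append_H, h1] at hu'
      rw [← h1, xEnd_append_H, List.length_reverse, hl] at hx'
      rw [← h1, yEnd_append_H] at hy'
      refine ⟨⟨⟨p, hq'.1, by omega, hy'⟩, ⟨(children k q, g), hu'⟩⟩, ?_⟩
      exact Subtype.ext (Prod.ext (Subtype.ext h1) rfl)

theorem card_forbidden (hk : 2 ≤ k) (n m : ℕ) (hd : (k - 1) * (m + 1) ≤ n + k) :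
    Nat.card (Forbidden k (n + k) m) = (m + 1) * Nat.card (BPath k n m) := by
  have := finite_bPath hk n m
  have : Fintype (BPath k n m) := Fintype.ofFinite _
  classical
  rw [← Nat.card_eq_of_bijective _ (bijective_repeatUpStep hk n m hd), Nat.card_sigma]
  have : ∀ p : BPath k n m, Nat.card {u : List ℕ × Bool // u ∈ upSteps k p.1} = m + 1 := by
    rintro ⟨p, hp, hx, hy⟩
    subst hy
    rw [← length_upSteps (k := k) p, ← List.toFinset_card_of_nodup (hp.nodup_upSteps hk),
      ← Nat.card_eq_finsetCard]
    simp only [List.mem_toFinset]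
  rw [Finset.sum_congr rfl fun p _ => this p, Finset.sum_const, Finset.card_univ, smul_eq_mul,
    mul_comm, Nat.card_eq_fintype_card]

/-- Here the leftmost leaf supplies the `k`-th zero, so no shorter path remains after deletion: this
single case is what `b k (-1) 0 = 1` records. -/
theorem card_forbidden_zero (hk : 2 ≤ k) : Nat.card (Forbidden k (k - 1) 0) = 1 := by
  have hw : children k (flatPath k (k - 1)).1 = List.replicate k 0 := by
    rw [children, flatPath, waiting_replicate, Nat.sub_add_cancel (by omega)]
    simp
  refine Nat.card_eq_one_iff_unique.2 ⟨⟨?_⟩, ⟨⟨(flatPath k (k - 1), false), ?_⟩⟩⟩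
  · rintro ⟨⟨p, g⟩, hp⟩ ⟨⟨p', g'⟩, hp'⟩
    obtain rfl := eq_flatPath p
    obtain rfl := eq_flatPath p'
    simp only [hw] at hp hp'
    simp only [flatPath, upSteps_replicate, List.mem_singleton, Prod.mk.injEq, true_and] at hp hp'
    subst hp hp'
    rfl
  · simp only [hw]
    simp [flatPath, upSteps_replicate]

theorem b_natCast (n m : ℕ) : b k n m = Nat.card (BPath k n m) := by simp [b]

theorem b_recurrence (hk : 2 ≤ k) {n m : ℕ} (hm : 1 ≤ m) (h : (k - 1) * m ≤ n) :
    b k n m = 2 * b k n (m - 1) + ((m : ℤ) + 1) * b k ((n : ℤ) - 1) m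
      - (m : ℤ) * b k ((n : ℤ) - (k : ℤ)) (m - 1) := by
  obtain ⟨m, rfl⟩ : ∃ m', m = m' + 1 := ⟨m - 1, by omega⟩
  have hn : k - 1 ≤ n := (Nat.le_mul_of_pos_right _ hm).trans h
  obtain ⟨n, rfl⟩ : ∃ n', n = n' + 1 := ⟨n - 1, by omega⟩
  have hadd := card_bPath_add hk n m h
  have hf : (Nat.card (Forbidden k (n + 1) m) : ℤ) =
      ((m + 1 : ℕ) : ℤ) * b k (((n + 1 : ℕ) : ℤ) - (k : ℤ)) m := by
    -- Equality is the corner `x = k - 1`, where the diagonal condition forces the first up step.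
    rcases hn.eq_or_lt with hn | hn
    · have hm0 : m = 0 := by
        rw [← hn] at h
        by_contra hm0
        have := Nat.mul_le_mul_left (k - 1) (show 2 ≤ m + 1 by omega)
        omega
      subst hm0
      rw [← hn, card_forbidden_zero hk, b, if_neg (by omega), if_pos (by omega)]
      rfl
    · obtain ⟨r, hr⟩ : ∃ r, n + 1 = r + k := ⟨n + 1 - k, by omega⟩
      rw [hr] at h
      rw [hr, card_forbidden hk r m h, Nat.cast_add r k, add_sub_cancel_right, b_natCast]
      push_cast
      ring
  rw [Nat.add_sub_cancel, ← hf, b_natCast, b_natCast,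
    show ((n + 1 : ℕ) : ℤ) - 1 = (n : ℤ) by push_cast; ring, b_natCast]
  push_cast
  have : (Nat.card (BPath k (n + 1) (m + 1)) : ℤ) + Nat.card (Forbidden k (n + 1) m) =
      2 * Nat.card (BPath k (n + 1) m) + (m + 2) * Nat.card (BPath k n (m + 1)) := by
    exact_mod_cast hadd
  linarith

end DecoratedPath

namespace DecoratedPath

variable {k : ℕ} {α : Type*}

/-! ### The languages of the nodes of a B-path -/

/-- The language of a node with colour `g` and children whose languages are `cs`. -/
def nodeLang (e : α ≃ Fin k) (g : Bool) (cs : List (Language α)) : Language α :=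
  {w | match w with
    | [] => g = true
    | a :: x => x ∈ cs.getD (e a) 0}

theorem nil_mem_nodeLang (e : α ≃ Fin k) (g : Bool) (cs : List (Language α)) :
    [] ∈ nodeLang e g cs ↔ g = true := Iff.rfl

theorem cons_mem_nodeLang (e : α ≃ Fin k) (g : Bool) (cs : List (Language α)) (a : α)
    (x : List α) : a :: x ∈ nodeLang e g cs ↔ x ∈ cs.getD (e a) 0 := Iff.rfl

theorem leftQuotient_cons (L : Language α) (a : α) (x : List α) :
    L.leftQuotient (a :: x) = (L.leftQuotient [a]).leftQuotient x :=
  L.leftQuotient_append [a] x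

theorem leftQuotient_nodeLang (e : α ≃ Fin k) (g : Bool) (cs : List (Language α)) (a : α) :
    (nodeLang e g cs).leftQuotient [a] = cs.getD (e a) 0 := by
  ext x
  exact cons_mem_nodeLang e g cs a x

/-- The empty word recovers the colour and the one-letter quotients recover the children; the
lengths matter because missing children default to `0`. -/
theorem nodeLang_injective (e : α ≃ Fin k) {g g' : Bool} {cs cs' : List (Language α)}
    (hc : cs.length = k) (hc' : cs'.length = k) (h : nodeLang e g cs = nodeLang e g' cs') :
    g = g' ∧ cs = cs' := by
  constructor
  · rw [Bool.eq_iff_iff, ← nil_mem_nodeLang e g cs, h, nil_mem_nodeLang]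
  · refine List.ext_getElem (hc.trans hc'.symm) fun i hi hi' => ?_
    have := leftQuotient_nodeLang e g cs (e.symm ⟨i, hc ▸ hi⟩)
    rw [h, leftQuotient_nodeLang] at this
    rw [Equiv.apply_symm_apply, List.getD_eq_getElem _ _ hi, List.getD_eq_getElem _ _ hi'] at this
    exact this.symm

theorem nodeLang_leftQuotient (e : α ≃ Fin k) (L : Language α) [Decidable ([] ∈ L)] :
    nodeLang e (decide ([] ∈ L)) (List.ofFn fun i => L.leftQuotient [e.symm i]) = L := by
  ext x
  cases x with
  | nil => simp [nil_mem_nodeLang]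
  | cons a x =>
    rw [cons_mem_nodeLang, List.getD_eq_getElem _ _ (by simp)]
    simp

theorem zero_leftQuotient (x : List α) : (0 : Language α).leftQuotient x = 0 := rfl

/-- Makes the sink satisfy the same equation as every other row. -/
theorem nodeLang_false_zero (e : α ≃ Fin k) :
    nodeLang e false (List.replicate k 0) = 0 := by
  ext x
  cases x with
  | nil => simp [nil_mem_nodeLang, Language.notMem_zero]
  | cons a x =>
    rw [cons_mem_nodeLang, List.getD_eq_getElem _ _ (by simp)]
    simp [Language.notMem_zero]

theorem finite_nodeLang [Finite α] (e : α ≃ Fin k) (g : Bool) {cs : List (Language α)}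
    (h : ∀ L ∈ cs, {w | w ∈ L}.Finite) : {w | w ∈ nodeLang e g cs}.Finite := by
  have : {w | w ∈ nodeLang e g cs} ⊆
      {[]} ∪ ⋃ a, (List.cons a) '' {x | x ∈ cs.getD (e a) 0} := by
    intro w hw
    cases w with
    | nil => simp
    | cons a x => exact Or.inr (Set.mem_iUnion.2 ⟨a, x, hw, rfl⟩)
  refine Set.Finite.subset ((Set.finite_singleton _).union
    (Set.finite_iUnion fun a => Set.Finite.image _ ?_)) this
  by_cases ha : (e a : ℕ) < cs.length
  · rw [List.getD_eq_getElem _ _ ha]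
    exact h _ (List.getElem_mem _)
  · rw [List.getD_eq_default _ _ (not_lt.1 ha)]
    simp [Language.notMem_zero]

theorem finite_leftQuotient {L : Language α} (h : {w | w ∈ L}.Finite) (x : List α) :
    {w | w ∈ L.leftQuotient x}.Finite :=
  Set.Finite.preimage (f := fun y => x ++ y) (List.append_right_injective x).injOn h

/-- Otherwise prefixing `a :: x` to a longest word of `L` gives a longer one. -/
theorem eq_zero_of_leftQuotient_eq {L : Language α} (h : {w | w ∈ L}.Finite) {a : α} {x : List α}
    (hx : L.leftQuotient (a :: x) = L) : L = 0 := by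
  by_contra h0
  have hne : {w | w ∈ L}.Nonempty := by
    rw [Set.nonempty_iff_ne_empty]
    exact h0
  obtain ⟨y, hy, hmax⟩ := Set.exists_max_image _ List.length h hne
  have hy' : y ∈ L.leftQuotient (a :: x) := by rw [hx]; exact hy
  have := hmax _ hy'
  simp at this

theorem exists_leftQuotient_eq_zero [Nonempty α] {L : Language α} (h : {w | w ∈ L}.Finite) :
    ∃ x, L.leftQuotient x = 0 := by
  obtain ⟨a⟩ := ‹Nonempty α›
  obtain ⟨N, hN⟩ := (h.image List.length).bddAbove
  refine ⟨List.replicate (N + 1) a, ?_⟩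
  ext y
  refine ⟨fun hy => ?_, fun hy => (Language.notMem_zero _ hy).elim⟩
  have := hN ⟨_, hy, rfl⟩
  simp at this
  omega

/-- The language of the node in the given row. -/
def rowLang (e : α ≃ Fin k) : List Step → ℕ → Language α
  | [] => fun _ => 0
  | Step.H _ :: q => rowLang e q
  | Step.V g :: q => Function.update (rowLang e q) (yEnd q + 1)
      (nodeLang e g ((children k q).map (rowLang e q)))

/-- The languages of the waiting nodes. -/
def forest (e : α ≃ Fin k) (q : List Step) : List (Language α) :=
  (waiting k q).map (rowLang e q)

theorem rowLang_V_of_le (e : α ≃ Fin k) (g : Bool) (q : List Step) {j : ℕ} (hj : j ≤ yEnd q) :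
    rowLang e (Step.V g :: q) j = rowLang e q j :=
  Function.update_of_ne (by omega) _ _

theorem rowLang_V_self (e : α ≃ Fin k) (g : Bool) (q : List Step) :
    rowLang e (Step.V g :: q) (yEnd q + 1) = nodeLang e g ((children k q).map (rowLang e q)) :=
  Function.update_self _ _ _

theorem map_rowLang_V (e : α ≃ Fin k) (g : Bool) (q : List Step) {l : List ℕ}
    (hl : ∀ c ∈ l, c ≤ yEnd q) : l.map (rowLang e (Step.V g :: q)) = l.map (rowLang e q) :=
  List.map_congr_left fun c hc => rowLang_V_of_le e g q (hl c hc)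

theorem map_children (e : α ≃ Fin k) (q : List Step) :
    (children k q).map (rowLang e q) = ((forest e q).take k).reverse := by
  rw [children, forest, List.map_reverse, List.map_take]

theorem forest_H (e : α ≃ Fin k) (c : ℕ) (q : List Step) :
    forest e (Step.H c :: q) = rowLang e q c :: forest e q := rfl

theorem forest_V (e : α ≃ Fin k) (g : Bool) {q : List Step} (hq : IsBPath k q) :
    forest e (Step.V g :: q) =
      nodeLang e g ((forest e q).take k).reverse :: (forest e q).drop k := by
  rw [forest, waiting, List.map_cons, rowLang_V_self, map_children, map_rowLang_V _ _ _
    fun c hc => hq.le_of_mem_waiting (List.mem_of_mem_drop hc), List.map_drop]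
  rfl

theorem finite_rowLang [Finite α] (e : α ≃ Fin k) (q : List Step) (j : ℕ) :
    {w | w ∈ rowLang e q j}.Finite := by
  induction q generalizing j with
  | nil => exact Set.finite_empty
  | cons s q ih =>
    cases s with
    | H c => exact ih j
    | V g =>
      by_cases hj : j = yEnd q + 1
      · subst hj
        rw [rowLang_V_self]
        refine finite_nodeLang e g fun L hL => ?_
        obtain ⟨c, -, rfl⟩ := List.mem_map.1 hL
        exact ih c
      · rw [rowLang, Function.update_of_ne hj]
        exact ih j

theorem IsBPath.rowLang_mem_upSteps (hk : 2 ≤ k) (e : α ≃ Fin k) {q : List Step}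
    (hq : IsBPath k q) {j : ℕ} (hj : j ≤ yEnd q) :
    ∃ u ∈ upSteps k q, rowLang e q j = nodeLang e u.2 (u.1.map (rowLang e q)) := by
  induction q with
  | nil =>
    refine ⟨_, List.mem_singleton.2 rfl, ?_⟩
    simp only [rowLang, List.map_replicate]
    exact (nodeLang_false_zero e).symm
  | cons s q ih =>
    cases s with
    | H c => exact ih hq.1 hj
    | V g =>
      rcases Nat.le_succ_iff.1 hj with hj | rfl
      · obtain ⟨u, hu, h⟩ := ih hq.1 hj
        refine ⟨u, List.mem_cons_of_mem _ hu, ?_⟩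
        rw [rowLang_V_of_le e g q hj, h, map_rowLang_V e g q fun c hc =>
          ((hq.1.of_mem_upSteps hk hu).2 c hc).trans (Nat.sub_le _ _)]
      · refine ⟨_, List.mem_cons_self, ?_⟩
        rw [map_rowLang_V e g q fun c hc => hq.1.le_of_mem_children hc]
        exact rowLang_V_self e g q

theorem IsBPath.exists_rowLang_of_mem_upSteps (hk : 2 ≤ k) (e : α ≃ Fin k) {q : List Step}
    (hq : IsBPath k q) {u : List ℕ × Bool} (hu : u ∈ upSteps k q) :
    ∃ j ≤ yEnd q, rowLang e q j = nodeLang e u.2 (u.1.map (rowLang e q)) := by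
  induction q with
  | nil =>
    obtain rfl : u = _ := by simpa [upSteps] using hu
    refine ⟨0, le_rfl, ?_⟩
    simp only [rowLang, List.map_replicate]
    exact (nodeLang_false_zero e).symm
  | cons s q ih =>
    cases s with
    | H c => exact ih hq.1 hu
    | V g =>
      rcases List.mem_cons.1 hu with rfl | hu
      · refine ⟨_, le_rfl, ?_⟩
        rw [map_rowLang_V e g q fun c hc => hq.1.le_of_mem_children hc]
        exact rowLang_V_self e g q
      · obtain ⟨j, hj, h⟩ := ih hq.1 hu
        refine ⟨j, hj.trans (Nat.le_succ _), ?_⟩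
        rw [rowLang_V_of_le e g q hj, h, map_rowLang_V e g q fun c hc =>
          ((hq.1.of_mem_upSteps hk hu).2 c hc).trans (Nat.sub_le _ _)]

/-- Equal languages would have equal colours and child languages, hence by injectivity on the old
rows equal child tuples: a repeated up step. -/
theorem rowLang_ne_of_injOn (hk : 2 ≤ k) (e : α ≃ Fin k) {q : List Step} {g : Bool}
    (hq : IsBPath k (Step.V g :: q)) (hinj : Set.InjOn (rowLang e q) (Set.Iic (yEnd q)))
    {j : ℕ} (hj : j ≤ yEnd q) :
    rowLang e q j ≠ nodeLang e g ((children k q).map (rowLang e q)) := by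
  intro h
  obtain ⟨u, hu, hju⟩ := hq.1.rowLang_mem_upSteps hk e hj
  obtain ⟨hl, hle⟩ := hq.1.of_mem_upSteps hk hu
  have hl' := length_children (hq.1.le_length_waiting hk hq.2.1)
  obtain ⟨rfl, hm⟩ := nodeLang_injective e (by simpa using hl) (by simpa using hl')
    (hju.symm.trans h)
  have hc : u.1 = children k q := by
    refine List.ext_getElem (hl.trans hl'.symm) fun i hi hi' => ?_
    refine hinj ((hle _ (List.getElem_mem hi)).trans (Nat.sub_le _ _))
      (hq.1.le_of_mem_children (List.getElem_mem hi')) ?_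
    have := List.getElem_of_eq hm (by simpa using hi)
    simpa using this
  rw [← Prod.mk.eta (p := u), hc] at hu
  exact ((isBPath_V_iff hk).1 hq).2.2 hu

theorem IsBPath.injOn_rowLang (hk : 2 ≤ k) (e : α ≃ Fin k) {q : List Step} (hq : IsBPath k q) :
    Set.InjOn (rowLang e q) (Set.Iic (yEnd q)) := by
  induction q with
  | nil =>
    intro i hi j hj _
    simp only [yEnd, Set.mem_Iic, Nat.le_zero] at hi hj
    rw [hi, hj]
  | cons s q ih =>
    cases s with
    | H c => exact ih hq.1
    | V g =>
      have hinj := ih hq.1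
      intro i hi j hj h
      rcases Nat.le_succ_iff.1 hi with hi | rfl <;> rcases Nat.le_succ_iff.1 hj with hj | rfl
      · rw [rowLang_V_of_le e g q hi, rowLang_V_of_le e g q hj] at h
        exact hinj hi hj h
      · rw [rowLang_V_of_le e g q hi, rowLang_V_self] at h
        exact (rowLang_ne_of_injOn hk e hq hinj hi h).elim
      · rw [rowLang_V_of_le e g q hj, rowLang_V_self] at h
        exact (rowLang_ne_of_injOn hk e hq hinj hj h.symm).elim
      · rfl

/-- The left quotients of the languages in a list. -/
def quotients (ws : List (Language α)) : Set (Language α) :=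
  {L | ∃ w ∈ ws, ∃ x, w.leftQuotient x = L}

theorem mem_quotients_cons {w : Language α} {ws : List (Language α)} {L : Language α} :
    L ∈ quotients (w :: ws) ↔ (∃ x, w.leftQuotient x = L) ∨ L ∈ quotients ws := by
  simp [quotients]

theorem mem_quotients_append {vs ws : List (Language α)} {L : Language α} :
    L ∈ quotients (vs ++ ws) ↔ L ∈ quotients vs ∨ L ∈ quotients ws := by
  simp [quotients, or_and_right, exists_or]

theorem mem_quotients_reverse {ws : List (Language α)} {L : Language α} :
    L ∈ quotients ws.reverse ↔ L ∈ quotients ws := by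
  simp [quotients]

theorem exists_leftQuotient_nodeLang (e : α ≃ Fin k) (g : Bool) {cs : List (Language α)}
    (hc : cs.length = k) {L : Language α} :
    (∃ x, (nodeLang e g cs).leftQuotient x = L) ↔ L = nodeLang e g cs ∨ L ∈ quotients cs := by
  constructor
  · rintro ⟨x, rfl⟩
    cases x with
    | nil => exact Or.inl rfl
    | cons a x =>
      have ha : (e a : ℕ) < cs.length := by omega
      refine Or.inr ⟨cs[(e a : ℕ)], ?_, x, ?_⟩
      · exact List.getElem_mem _
      · rw [leftQuotient_cons, leftQuotient_nodeLang, List.getD_eq_getElem _ _ ha]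
  · rintro (rfl | ⟨w, hw, x, rfl⟩)
    · exact ⟨[], rfl⟩
    · obtain ⟨i, hi, rfl⟩ := List.getElem_of_mem hw
      refine ⟨e.symm ⟨i, hc ▸ hi⟩ :: x, ?_⟩
      rw [leftQuotient_cons, leftQuotient_nodeLang, Equiv.apply_symm_apply,
        List.getD_eq_getElem _ _ hi]

theorem length_forest (e : α ≃ Fin k) (q : List Step) :
    (forest e q).length = (waiting k q).length := List.length_map _

/-- An `H` adds a language that is already a quotient; a `V` replaces `k` languages by a node whose
quotients are itself and theirs. -/
theorem IsBPath.quotients_forest (hk : 2 ≤ k) (e : α ≃ Fin k) {q : List Step}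
    (hq : IsBPath k q) : quotients (forest e q) = rowLang e q '' Set.Iic (yEnd q) := by
  induction q with
  | nil =>
    ext L
    simp [forest, waiting, rowLang, quotients, yEnd, zero_leftQuotient]
  | cons s q ih =>
    cases s with
    | H c =>
      change quotients (rowLang e q c :: forest e q) = rowLang e q '' Set.Iic (yEnd q)
      rw [← ih hq.1]
      ext L
      rw [mem_quotients_cons, or_iff_right_iff_imp]
      rintro ⟨x, rfl⟩
      have : rowLang e q c ∈ quotients (forest e q) := by
        rw [ih hq.1]
        exact ⟨c, hq.2, rfl⟩
      obtain ⟨w, hw, y, hy⟩ := this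
      exact ⟨w, hw, y ++ x, by rw [Language.leftQuotient_append, hy]⟩
    | V g =>
      have hw := hq.1.le_length_waiting hk hq.2.1
      ext L
      rw [forest_V e g hq.1, mem_quotients_cons, exists_leftQuotient_nodeLang e g
        (by simpa [length_forest] using hw), or_assoc, mem_quotients_reverse,
        ← mem_quotients_append, List.take_append_drop, ih hq.1, ← map_children]
      constructor
      · rintro (rfl | ⟨j, hj, rfl⟩)
        · exact ⟨yEnd q + 1, Set.mem_Iic.2 le_rfl, rowLang_V_self e g q⟩
        · exact ⟨j, le_trans hj (Nat.le_succ _), rowLang_V_of_le e g q hj⟩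
      · rintro ⟨j, hj, rfl⟩
        rcases Nat.le_succ_iff.1 hj with hj | rfl
        · exact Or.inr ⟨j, hj, (rowLang_V_of_le e g q hj).symm⟩
        · exact Or.inl (rowLang_V_self e g q)

theorem IsBPath.ncard_quotients_forest (hk : 2 ≤ k) (e : α ≃ Fin k) {q : List Step}
    (hq : IsBPath k q) : (quotients (forest e q)).ncard = yEnd q + 1 := by
  rw [hq.quotients_forest hk e, (hq.injOn_rowLang hk e).ncard_image]
  simp [Set.ncard_eq_toFinset_card']

theorem IsBPath.nodeLang_notMem_quotients (hk : 2 ≤ k) (e : α ≃ Fin k) {q : List Step} {g : Bool}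
    (hq : IsBPath k (Step.V g :: q)) :
    nodeLang e g ((forest e q).take k).reverse ∉ quotients (forest e q) := by
  rw [hq.1.quotients_forest hk e, ← map_children]
  rintro ⟨j, hj, h⟩
  exact rowLang_ne_of_injOn hk e hq (hq.1.injOn_rowLang hk e) hj h

theorem IsBPath.length_forest_pos (hk : 2 ≤ k) (e : α ≃ Fin k) {q : List Step}
    (hq : IsBPath k q) : 0 < (forest e q).length := by
  have := hq.length_waiting hk
  have := hq.le_diagonal
  rw [length_forest]
  omega

/-! ### Recovering a path from its waiting languages -/

theorem forest_H_ne_forest_V (hk : 2 ≤ k) (e : α ≃ Fin k) {q q' : List Step} {c : ℕ} {g : Bool}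
    (hq : IsBPath k (Step.H c :: q)) (hq' : IsBPath k (Step.V g :: q')) :
    forest e (Step.H c :: q) ≠ forest e (Step.V g :: q') := by
  intro h
  rw [forest_H, forest_V e g hq'.1, List.cons.injEq] at h
  apply hq'.nodeLang_notMem_quotients hk e
  have hmem : rowLang e q c ∈ quotients (forest e q) := by
    rw [hq.1.quotients_forest hk e]
    exact ⟨c, hq.2, rfl⟩
  rw [h.1, h.2] at hmem
  obtain ⟨w, hw, hx⟩ := hmem
  exact ⟨w, List.mem_of_mem_drop hw, hx⟩

theorem forest_nil_ne_forest_cons (hk : 2 ≤ k) (e : α ≃ Fin k) {s : Step} {q : List Step}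
    (hq : IsBPath k (s :: q)) : forest e [] ≠ forest e (s :: q) := by
  intro h
  cases s with
  | H c =>
    have h1 := congrArg List.length h
    have h2 := hq.1.length_forest_pos hk e
    rw [forest_H] at h1
    simp only [forest, waiting, List.map_cons, List.map_nil, List.length_cons, List.length_nil,
      List.length_map] at h1 h2
    omega
  | V g =>
    rw [forest_V e g hq.1] at h
    apply hq.nodeLang_notMem_quotients hk e
    rw [← (List.cons.inj h).1]
    rw [hq.1.quotients_forest hk e]
    refine ⟨0, Nat.zero_le _, ?_⟩
    clear h hq
    induction q with
    | nil => rfl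
    | cons s q ih =>
      cases s with
      | H c => exact ih
      | V g => rw [rowLang_V_of_le _ _ _ (Nat.zero_le _), ih]

theorem forest_injective (hk : 2 ≤ k) (e : α ≃ Fin k) {q q' : List Step} (hq : IsBPath k q)
    (hq' : IsBPath k q') (h : forest e q = forest e q') : q = q' := by
  induction q generalizing q' with
  | nil =>
    cases q' with
    | nil => rfl
    | cons s q' => exact (forest_nil_ne_forest_cons hk e hq' h).elim
  | cons s q ih =>
    cases q' with
    | nil => exact (forest_nil_ne_forest_cons hk e hq h.symm).elim
    | cons s' q' =>
      cases s with
      | H c =>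
        cases s' with
        | H c' =>
          rw [forest_H, forest_H, List.cons.injEq] at h
          obtain rfl := ih hq.1 hq'.1 h.2
          rw [hq.1.injOn_rowLang hk e hq.2 hq'.2 h.1]
        | V g' => exact (forest_H_ne_forest_V hk e hq hq' h).elim
      | V g =>
        cases s' with
        | H c' => exact (forest_H_ne_forest_V hk e hq' hq h.symm).elim
        | V g' =>
          rw [forest_V e g hq.1, forest_V e g' hq'.1, List.cons.injEq] at h
          have hw := hq.1.le_length_waiting hk hq.2.1
          have hw' := hq'.1.le_length_waiting hk hq'.2.1
          obtain ⟨rfl, h1⟩ := nodeLang_injective e (by simpa [length_forest] using hw)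
            (by simpa [length_forest] using hw') h.1
          rw [ih hq.1 hq'.1]
          rw [← List.take_append_drop k (forest e q), ← List.take_append_drop k (forest e q'),
            h.2, List.reverse_injective h1]

/-- Undo the last step. If the head is a quotient of the tail, it came from an `H` and the list
shortens. Otherwise, unless the list is `[0]`, it came from a `V`: replacing the head by its
one-letter quotients loses the head itself as a quotient. The outer induction on `N` bounds the
number of quotients, the inner one follows the list. -/
theorem exists_forest_eq (hk : 2 ≤ k) (e : α ≃ Fin k) (N : ℕ) (ws : List (Language α))
    (hne : ws ≠ []) (hfin : ∀ w ∈ ws, {x | x ∈ w}.Finite) (hq : (quotients ws).Finite)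
    (hN : (quotients ws).ncard < N) : ∃ q, IsBPath k q ∧ forest e q = ws := by
  have hα : Nonempty α := ⟨e.symm ⟨0, by omega⟩⟩
  induction N generalizing ws with
  | zero => omega
  | succ N ihN =>
    induction ws with
    | nil => exact (hne rfl).elim
    | cons w ws ihw =>
      have hsub : quotients ws ⊆ quotients (w :: ws) := fun L hL =>
        mem_quotients_cons.2 (Or.inr hL)
      have hfin' : ∀ v ∈ ws, {x | x ∈ v}.Finite := fun v hv => hfin v (List.mem_cons_of_mem _ hv)
      have hw := hfin w List.mem_cons_self
      by_cases h1 : w ∈ quotients ws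
      · have hne' : ws ≠ [] := by
          rintro rfl
          simp [quotients] at h1
        obtain ⟨q, hq', hf⟩ := ihw hne' hfin' (hq.subset hsub)
          ((Set.ncard_le_ncard hsub hq).trans_lt hN)
        rw [← hf, hq'.quotients_forest hk e] at h1
        obtain ⟨c, hc, hcw⟩ := h1
        exact ⟨Step.H c :: q, ⟨hq', hc⟩, by rw [forest_H, hcw, hf]⟩
      by_cases h2 : w = 0
      -- Every finite language has `0` as a quotient, so a head `0` that is new must stand alone.
      · rcases ws with _ | ⟨v, ws⟩
        · exact ⟨[], trivial, by rw [h2]; rfl⟩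
        · obtain ⟨x, hx⟩ := exists_leftQuotient_eq_zero (hfin' v List.mem_cons_self)
          exact (h1 ⟨v, List.mem_cons_self, x, hx.trans h2.symm⟩).elim
      set cs := List.ofFn fun i => w.leftQuotient [e.symm i] with hcs
      have hlen : cs.length = k := by simp [hcs]
      have hmem : ∀ {L}, L ∈ quotients (cs.reverse ++ ws) ↔ L ∈ quotients cs ∨ L ∈ quotients ws :=
        by intro L; rw [mem_quotients_append, mem_quotients_reverse]
      have hcsq : ∀ {L}, L ∈ quotients cs → ∃ a x, w.leftQuotient (a :: x) = L := by
        rintro L ⟨v, hv, x, rfl⟩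
        obtain ⟨i, rfl⟩ := List.mem_ofFn.1 hv
        exact ⟨_, x, leftQuotient_cons _ _ _⟩
      have hnot : w ∉ quotients (cs.reverse ++ ws) := by
        rw [hmem]
        rintro (h | h)
        · obtain ⟨a, x, hx⟩ := hcsq h
          exact h2 (eq_zero_of_leftQuotient_eq hw hx)
        · exact h1 h
      have hss : quotients (cs.reverse ++ ws) ⊂ quotients (w :: ws) := by
        refine (Set.ssubset_iff_of_subset fun L hL => ?_).2
          ⟨w, mem_quotients_cons.2 (Or.inl ⟨[], rfl⟩), hnot⟩
        rcases hmem.1 hL with h | h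
        · obtain ⟨a, x, hx⟩ := hcsq h
          exact mem_quotients_cons.2 (Or.inl ⟨_, hx⟩)
        · exact hsub h
      obtain ⟨q, hq', hf⟩ := ihN (cs.reverse ++ ws)
        (by intro h; have := congrArg List.length h; simp [hlen] at this; omega)
        (by
          intro v hv
          rcases List.mem_append.1 hv with hv | hv
          · obtain ⟨i, rfl⟩ := List.mem_ofFn.1 (List.mem_reverse.1 hv)
            exact finite_leftQuotient hw _
          · exact hfin' v hv)
        (hq.subset hss.subset)
        (by have := Set.ncard_lt_ncard hss hq; omega)
      classical
      have htake : ((forest e q).take k).reverse = cs := by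
        rw [hf, List.take_left' (by simp [hlen]), List.reverse_reverse]
      have hnode : nodeLang e (decide ([] ∈ w)) ((forest e q).take k).reverse = w := by
        rw [htake]
        exact nodeLang_leftQuotient e w
      refine ⟨Step.V (decide ([] ∈ w)) :: q, (isBPath_V_iff hk).2 ⟨hq', ?_, fun hu => ?_⟩, ?_⟩
      · have h3 := hq'.length_waiting hk
        have h4 := congrArg List.length hf
        rw [length_forest, List.length_append, List.length_reverse, hlen] at h4
        rw [Nat.mul_succ]
        omega
      -- A repeated up step would make `w` the language of an old row, hence a quotient of the
      -- shorter forest.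
      · obtain ⟨j, hj, h⟩ := hq'.exists_rowLang_of_mem_upSteps hk e hu
        rw [map_children, hnode] at h
        apply hnot
        rw [← hf, hq'.quotients_forest hk e]
        exact ⟨j, hj, h⟩
      · rw [forest_V e _ hq', hnode, hf, List.drop_left' (by simp [hlen])]

/-- The language of a B-path whose construction has ended with a single root. -/
def rootLang (e : α ≃ Fin k) (q : List Step) : Language α :=
  (forest e q).headD 0

theorem forest_eq_singleton (hk : 2 ≤ k) (e : α ≃ Fin k) {n : ℕ} (p : BPath k ((k - 1) * n) n) :
    forest e p.1 = [rootLang e p.1] := by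
  obtain ⟨p, hp, hx, hy⟩ := p
  have h := hp.length_waiting hk
  rw [hx, hy, ← length_forest e] at h
  obtain ⟨L, hL⟩ := List.length_eq_one_iff.1 (show (forest e p).length = 1 by omega)
  simp [rootLang, hL]

/-- The finite languages with `s` left quotients. -/
def FiniteLanguage (α : Type*) (s : ℕ) : Type _ :=
  {L : Language α // {w | w ∈ L}.Finite ∧ (Set.range L.leftQuotient).ncard = s}

theorem quotients_singleton (L : Language α) : quotients [L] = Set.range L.leftQuotient := by
  ext; simp [quotients]

theorem card_finiteLanguage [Finite α] (hk : 2 ≤ k) (e : α ≃ Fin k) (n : ℕ) :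
    Nat.card (BPath k ((k - 1) * n) n) = Nat.card (FiniteLanguage α (n + 1)) ∧
      Finite (FiniteLanguage α (n + 1)) := by
  let f : BPath k ((k - 1) * n) n → FiniteLanguage α (n + 1) := fun p =>
    ⟨rootLang e p.1, by
      have h : rootLang e p.1 ∈ forest e p.1 := by
        rw [forest_eq_singleton hk e p]; exact List.mem_singleton_self _
      obtain ⟨c, -, hc⟩ := List.mem_map.1 h
      rw [← hc]
      exact finite_rowLang e p.1 c, by
      rw [← quotients_singleton, ← forest_eq_singleton hk e p, p.2.1.ncard_quotients_forest hk e,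
        p.2.2.2]⟩
  have hf : Function.Bijective f := by
    constructor
    · intro p p' h
      have h1 : rootLang e p.1 = rootLang e p'.1 := congrArg Subtype.val h
      refine Subtype.ext (forest_injective hk e p.2.1 p'.2.1 ?_)
      rw [forest_eq_singleton hk e p, forest_eq_singleton hk e p', h1]
    · rintro ⟨L, hL, hc⟩
      rw [← quotients_singleton] at hc
      obtain ⟨q, hq, hqL⟩ := exists_forest_eq hk e (n + 2) [L] (by simp) (by simpa using hL)
        (Set.finite_of_ncard_ne_zero (by omega)) (by omega)
      have hy := hq.ncard_quotients_forest hk e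
      rw [hqL, hc] at hy
      obtain rfl : n = yEnd q := by omega
      have hx := hq.length_waiting hk
      rw [← length_forest e, hqL, List.length_singleton] at hx
      refine ⟨⟨q, hq, by omega, rfl⟩, Subtype.ext ?_⟩
      change rootLang e q = L
      rw [rootLang, hqL]
      rfl
  have := finite_bPath hk ((k - 1) * n) n
  exact ⟨Nat.card_eq_of_bijective f hf, Finite.of_surjective f hf.2⟩

end DecoratedPath

namespace MinimalAutomaton

/-! ### Minimal automata and left quotients -/

theorem range_leftQuotient_subset {α : Type*} {s : ℕ} (M : DFA α (Fin s)) :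
    Set.range M.accepts.leftQuotient ⊆ Set.range M.acceptsFrom := by
  rw [Language.leftQuotient_accepts]
  exact Set.range_comp_subset_range _ _

theorem ncard_range_acceptsFrom_le {α : Type*} {s : ℕ} (M : DFA α (Fin s)) :
    (Set.range M.acceptsFrom).ncard ≤ s := by
  rw [← Set.image_univ]
  exact (Set.ncard_image_le Set.finite_univ).trans (by simp)

/-- A language is accepted by an automaton with as many states as it has left quotients. -/
theorem exists_dfa_accepts {α : Type*} {L : Language α} (h : (Set.range L.leftQuotient).Finite) :
    ∃ M : DFA α (Fin (Set.range L.leftQuotient).ncard), M.accepts = L := by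
  have : Finite (Set.range L.leftQuotient) := h
  have e : Set.range L.leftQuotient ≃ Fin (Set.range L.leftQuotient).ncard :=
    Finite.equivFinOfCardEq (Nat.card_coe_set_eq _)
  exact ⟨DFA.reindex e L.toDFA, by simp⟩

/-- Each left quotient is the language accepted from some state, so no automaton has fewer states
than quotients; the quotient automaton attains this bound. -/
theorem isMinimal_iff {α : Type*} {s : ℕ} {M : DFA α (Fin s)} :
    IsMinimal M ↔ (Set.range M.accepts.leftQuotient).ncard = s := by
  have hfin : ∀ {t : ℕ} (M' : DFA α (Fin t)), (Set.range M'.acceptsFrom).Finite :=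
    fun M' => Set.finite_range _
  have hle : ∀ {t : ℕ} (M' : DFA α (Fin t)), (Set.range M'.accepts.leftQuotient).ncard ≤ t :=
    fun M' => (Set.ncard_le_ncard (range_leftQuotient_subset M') (hfin M')).trans
      (ncard_range_acceptsFrom_le M')
  constructor
  · intro h
    obtain ⟨M', hM'⟩ := exists_dfa_accepts ((hfin M).subset (range_leftQuotient_subset M))
    exact le_antisymm (hle M) (h _ M' hM')
  · intro h t M' hM'
    rw [← h, ← hM']
    exact hle M'

theorem IsMinimal.range_acceptsFrom {α : Type*} {s : ℕ} {M : DFA α (Fin s)} (h : IsMinimal M) :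
    Set.range M.acceptsFrom = Set.range M.accepts.leftQuotient :=
  (Set.eq_of_subset_of_ncard_le (range_leftQuotient_subset M)
    (by rw [isMinimal_iff.1 h]; exact ncard_range_acceptsFrom_le M) (Set.finite_range _)).symm

theorem IsMinimal.injective_acceptsFrom {α : Type*} {s : ℕ} {M : DFA α (Fin s)}
    (h : IsMinimal M) : Function.Injective M.acceptsFrom := by
  rw [← Set.injOn_univ]
  refine Set.injOn_of_ncard_image_eq ?_ Set.finite_univ
  rw [Set.image_univ, h.range_acceptsFrom, isMinimal_iff.1 h]
  simp

theorem acceptsFrom_step {α σ : Type*} (M : DFA α σ) (q : σ) (a : α) :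
    M.acceptsFrom (M.step q a) = (M.acceptsFrom q).leftQuotient [a] := rfl

theorem dfa_ext {α σ : Type*} {M N : DFA α σ} (hstep : M.step = N.step)
    (hstart : M.start = N.start) (haccept : M.accept = N.accept) : M = N := by
  cases M
  cases N
  simp_all

/-- Minimal automata of the same language are isomorphic. -/
theorem IsMinimal.exists_reindex_eq {α : Type*} {s : ℕ} {M N : DFA α (Fin s)}
    (hM : IsMinimal M) (hN : IsMinimal N) (h : M.accepts = N.accepts) :
    ∃ e : Fin s ≃ Fin s, DFA.reindex e M = N := by
  have hr : Set.range M.acceptsFrom = Set.range N.acceptsFrom := by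
    rw [hM.range_acceptsFrom, hN.range_acceptsFrom, h]
  -- Each state of `M` goes to the unique state of `N` from which the same language is accepted.
  let e : Fin s ≃ Fin s := (Equiv.ofInjective _ hM.injective_acceptsFrom).trans
    ((Equiv.setCongr hr).trans (Equiv.ofInjective _ hN.injective_acceptsFrom).symm)
  have he : ∀ q, N.acceptsFrom (e q) = M.acceptsFrom q := fun q =>
    Equiv.apply_ofInjective_symm hN.injective_acceptsFrom _
  have he' : ∀ q, M.acceptsFrom (e.symm q) = N.acceptsFrom q := fun q => by
    rw [← he, Equiv.apply_symm_apply]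
  refine ⟨e, dfa_ext ?_ ?_ ?_⟩
  · funext q a
    apply hN.injective_acceptsFrom
    change N.acceptsFrom (e (M.step (e.symm q) a)) = _
    rw [he, acceptsFrom_step, acceptsFrom_step, he']
  · apply hN.injective_acceptsFrom
    change N.acceptsFrom (e M.start) = _
    rw [he]
    exact h
  · ext q
    change e.symm q ∈ M.accept ↔ _
    have h1 : [] ∈ M.acceptsFrom (e.symm q) ↔ [] ∈ N.acceptsFrom q := by rw [he']
    exact h1

theorem exists_bijective_minDFAClass (α : Type*) (s : ℕ) (hs : s ≠ 0) :
    ∃ f : MinDFAClass α s → DecoratedPath.FiniteLanguage α s, Function.Bijective f := by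
  let f : MinDFAClass α s → DecoratedPath.FiniteLanguage α s :=
    Quotient.lift (fun M : MinDFA α s => ⟨M.1.accepts, M.2.2, isMinimal_iff.1 M.2.1⟩) (by
      rintro M N ⟨e, he⟩
      exact Subtype.ext (by dsimp only; rw [← he, DFA.accepts_reindex]))
  refine ⟨f, ?_, ?_⟩
  · intro x y
    refine Quotient.inductionOn₂ x y fun M N h => Quotient.sound ?_
    exact M.2.1.exists_reindex_eq N.2.1 (congrArg Subtype.val h)
  · rintro ⟨L, hL, hc⟩
    -- `Set.ncard` is also `0` on infinite sets; `s ≠ 0` rules this out.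
    obtain ⟨M, hM⟩ := exists_dfa_accepts (Set.finite_of_ncard_ne_zero (hc.trans_ne hs))
    subst hc
    refine ⟨Quotient.mk _ ⟨M, isMinimal_iff.2 (by rw [hM]), by rw [hM]; exact hL⟩, ?_⟩
    exact Subtype.ext hM

end MinimalAutomaton

theorem mainTheorem5 (k : ℕ) (hk : 2 ≤ k) :
    (∀ n m : ℕ, Finite (DecoratedPath.BPath k n m)) ∧
    (∀ n m : ℕ, 1 ≤ m → (m : ℚ) ≤ (n : ℚ) / ((k : ℚ) - 1) →
      DecoratedPath.b k n m =
        2 * DecoratedPath.b k n (m - 1) + ((m : ℤ) + 1) * DecoratedPath.b k ((n : ℤ) - 1) m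
          - (m : ℤ) * DecoratedPath.b k ((n : ℤ) - (k : ℤ)) (m - 1)) ∧
    (∀ n m : ℕ, (n : ℚ) / ((k : ℚ) - 1) < (m : ℚ) → DecoratedPath.b k n m = 0) ∧
    (∀ n : ℕ, DecoratedPath.b k n 0 = 1) ∧
    (∀ (α : Type*) [Fintype α], Fintype.card α = k → ∀ n : ℕ,
      Finite (MinimalAutomaton.MinDFAClass α (n + 1)) ∧
      (Nat.card (MinimalAutomaton.MinDFAClass α (n + 1)) : ℤ) =
        DecoratedPath.b k (((k - 1) * n : ℕ) : ℤ) n) := by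
  have hk0 : (0 : ℚ) < (k : ℚ) - 1 := by
    have : (2 : ℚ) ≤ k := by exact_mod_cast hk
    linarith
  have hcast : (k : ℚ) - 1 = ((k - 1 : ℕ) : ℚ) := by rw [Nat.cast_sub (by omega), Nat.cast_one]
  refine ⟨DecoratedPath.finite_bPath hk, fun n m hm h => ?_, fun n m h => ?_, fun n => ?_,
    fun α _ hα n => ?_⟩
  · rw [le_div_iff₀ hk0, mul_comm, hcast] at h
    exact DecoratedPath.b_recurrence hk hm (by exact_mod_cast h)
  · rw [div_lt_iff₀ hk0, mul_comm, hcast] at h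
    have := DecoratedPath.isEmpty_bPath (k := k) (n := n) (m := m) (by exact_mod_cast h)
    rw [DecoratedPath.b_natCast, Nat.card_of_isEmpty, Nat.cast_zero]
  · rw [DecoratedPath.b_natCast, DecoratedPath.card_bPath_zero, Nat.cast_one]
  · obtain ⟨f, hf⟩ := MinimalAutomaton.exists_bijective_minDFAClass α (n + 1) (Nat.succ_ne_zero n)
    obtain ⟨h1, h2⟩ := DecoratedPath.card_finiteLanguage hk (Fintype.equivFinOfCardEq hα) n
    exact ⟨Finite.of_injective f hf.1, by
      rw [DecoratedPath.b_natCast, h1, Nat.card_eq_of_bijective f hf]⟩
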